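/- Let $\alpha_0,\alpha_1,\alpha_2,\alpha_3$ be four proper Euclidean displacements of $\mathbb{R}^3$ forming a rotation quadrangle: every relative displacement $\alpha_{i+1}\circ\alpha_i^{-1}$ (indices modulo four) is a pure rotation, i.e. its set of fixed points is a straight line. Let $r_{i,i+1}=\{X : \alpha_i(X)=\alpha_{i+1}(X)\}$ be the four relative revolute axes in the moving space, and call a straight line that meets all four axes a transversal. Call an oriented plane $\varepsilon$ of the moving space a solution if there is a cone of revolution (with a proper apex and half-angle strictly between $0$ and $\pi/2$, suitably oriented) that is in oriented contact with the four homologous planes $\alpha_0(\varepsilon),\dots,\alpha_3(\varepsilon)$: each of these planes passes through the apex and its oriented unit normal is the oriented unit normal of the cone along a generator. Assume that the quadrangle is generic in the following sense: the four axes do not all pass through one point; they are not all parallel to one plane; and whenever $\ell$ is one of the axes or a transversal, the four lines $\alpha_0(\ell),\dots,\alpha_3(\ell)$ are not all parallel to one plane. Then an oriented plane is a solution if and only if it is orthogonal to one of the four axes or to a transversal. In particular, if there are exactly two (real) transversals $u\neq v$, then the set of all solution planes consists of exactly six pairwise disjoint pencils of parallel planes (each taken with both orientations): the planes orthogonal to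 one of $r_{01}$, $r_{12}$, $r_{23}$, $r_{30}$, and the planes orthogonal to $u$ or to $v$. -/

import Mathlib

open scoped RealInnerProductSpace

/-- Euclidean three-space. -/
abbrev Space : Type := EuclideanSpace ℝ (Fin 3)

/-- A (proper) Euclidean displacement: an isometry of space that preserves orientation. -/
def IsDisplacement (τ : Space ≃ᵃⁱ[ℝ] Space) : Prop :=
  LinearMap.det (τ.linearIsometryEquiv.toLinearEquiv : Space →ₗ[ℝ] Space) = 1

/-- A straight line of Euclidean space. -/
def IsLine (l : AffineSubspace ℝ Space) : Prop :=
  (l : Set Space).Nonempty ∧ Module.finrank ℝ l.direction = 1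

/-- A pure rotation: a displacement whose fixed points are exactly the points of a line. -/
def IsPureRotation (τ : Space ≃ᵃⁱ[ℝ] Space) : Prop :=
  IsDisplacement τ ∧ ∃ l : AffineSubspace ℝ Space, IsLine l ∧ ∀ x : Space, τ x = x ↔ x ∈ l

/-- Four displacements `α 0, α 1, α 2, α 3` (indices modulo four) such that all relative
displacements `α (i + 1) ∘ (α i)⁻¹` are pure rotations. -/
def IsRotationQuadrangle (α : Fin 4 → Space ≃ᵃⁱ[ℝ] Space) : Prop :=
  (∀ i, IsDisplacement (α i)) ∧ ∀ i, IsPureRotation ((α i).symm.trans (α (i + 1)))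

/-- The relative revolute axis `r_{i,i+1}` in the moving space: the locus of the points `X` with
`α i X = α (i + 1) X`. -/
def revoluteAxis (α : Fin 4 → Space ≃ᵃⁱ[ℝ] Space) (i : Fin 4) : AffineSubspace ℝ Space where
  carrier := {x | α i x = α (i + 1) x}
  smul_vsub_vadd_mem' := by
    intro c x y z hx hy hz
    simp only [Set.mem_ofPred_eq] at hx hy hz ⊢
    rw [AffineIsometryEquiv.map_vadd, AffineIsometryEquiv.map_vadd, hz]
    congr 1
    rw [map_smul, map_smul, AffineIsometryEquiv.map_vsub, AffineIsometryEquiv.map_vsub, hx, hy]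

theorem mem_revoluteAxis (α : Fin 4 → Space ≃ᵃⁱ[ℝ] Space) (i : Fin 4) (x : Space) :
    x ∈ revoluteAxis α i ↔ α i x = α (i + 1) x := Iff.rfl

/-- The revolute axis consists of the points whose `α i`-images are fixed by the relative
displacement. -/
theorem mem_revoluteAxis_iff_fixed (α : Fin 4 → Space ≃ᵃⁱ[ℝ] Space) (i : Fin 4) (x : Space) :
    x ∈ revoluteAxis α i ↔ ((α i).symm.trans (α (i + 1))) (α i x) = α i x := by
  rw [mem_revoluteAxis]
  simp [eq_comm]

/-- A transversal of the four revolute axes: a line that meets each of them. -/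
def IsTransversal (α : Fin 4 → Space ≃ᵃⁱ[ℝ] Space) (l : AffineSubspace ℝ Space) : Prop :=
  IsLine l ∧ ∀ i, ∃ x : Space, x ∈ l ∧ x ∈ revoluteAxis α i

/-- An oriented plane, given by its oriented unit normal vector and its signed distance from
the origin. -/
@[ext]
structure OrientedPlane where
  normal : Space
  offset : ℝ
  norm_normal : ‖normal‖ = 1

namespace OrientedPlane

/-- The points of an oriented plane. -/
def points (e : OrientedPlane) : Set Space := {x | ⟪e.normal, x⟫ = e.offset}

/-- The image of an oriented plane under a displacement. -/
noncomputable def image (τ : Space ≃ᵃⁱ[ℝ] Space) (e : OrientedPlane) : OrientedPlane where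
  normal := τ.linearIsometryEquiv e.normal
  offset := e.offset + ⟪τ.linearIsometryEquiv e.normal, τ 0⟫
  norm_normal := by rw [LinearIsometryEquiv.norm_map, e.norm_normal]

theorem mem_points_image (τ : Space ≃ᵃⁱ[ℝ] Space) (e : OrientedPlane) (x : Space) :
    τ x ∈ (e.image τ).points ↔ x ∈ e.points := by
  have h : τ x = τ.linearIsometryEquiv x + τ 0 := by
    have := τ.map_vadd (0 : Space) x
    simpa using this
  simp only [points, image, Set.mem_ofPred_eq]
  rw [h, inner_add_right, LinearIsometryEquiv.inner_map_map]
  exact add_left_inj _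

/-- The point set of the image plane is the image of the point set. -/
theorem points_image (τ : Space ≃ᵃⁱ[ℝ] Space) (e : OrientedPlane) :
    (e.image τ).points = τ '' e.points := by
  ext y
  obtain ⟨x, rfl⟩ := τ.surjective y
  rw [mem_points_image]
  exact (τ.injective.mem_set_image).symm

end OrientedPlane

/-- An oriented cone of revolution. `apex` and the unit vector `axis` determine the cone axis and
`angle` is the angle between the axis and the generators. The two orientations of
one and the same cone correspond to the two choices of the sign of `axis`. -/
structure RevolutionCone where
  apex : Space
  axis : Space
  angle : ℝ
  norm_axis : ‖axis‖ = 1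
  angle_pos : 0 < angle
  angle_lt : angle < Real.pi / 2

namespace RevolutionCone

/-- The points of the (double) cone. -/
def points (C : RevolutionCone) : Set Space :=
  {x | ⟪x - C.apex, C.axis⟫ ^ 2 = Real.cos C.angle ^ 2 * ‖x - C.apex‖ ^ 2}

/-- The generators of the cone are the lines through the apex with these unit direction vectors. -/
def IsGenerator (C : RevolutionCone) (g : Space) : Prop :=
  ‖g‖ = 1 ∧ ⟪g, C.axis⟫ = Real.cos C.angle

/-- The oriented unit normal vector of the cone along the generator with direction `g`. -/
noncomputable def normalAlong (C : RevolutionCone) (g : Space) : Space :=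
  (Real.sin C.angle)⁻¹ • (C.axis - Real.cos C.angle • g)

/-- Oriented contact of an oriented plane and an oriented cone of revolution: the plane passes
through the apex, and its oriented normal is the oriented normal of the cone along some generator
(which is then contained in the plane). -/
def OrientedContact (C : RevolutionCone) (e : OrientedPlane) : Prop :=
  C.apex ∈ e.points ∧ ∃ g, C.IsGenerator g ∧ e.normal = C.normalAlong g

theorem sin_pos (C : RevolutionCone) : 0 < Real.sin C.angle :=
  Real.sin_pos_of_pos_of_lt_pi C.angle_pos (by linarith [C.angle_lt, Real.pi_pos])

theorem cos_pos (C : RevolutionCone) : 0 < Real.cos C.angle :=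
  Real.cos_pos_of_mem_Ioo ⟨by linarith [C.angle_pos, Real.pi_pos], C.angle_lt⟩

/-- Oriented contact means that the plane passes through the apex and that its oriented unit normal
encloses the angle `π / 2 - angle` with the axis. -/
theorem orientedContact_iff (C : RevolutionCone) (e : OrientedPlane) :
    C.OrientedContact e ↔ C.apex ∈ e.points ∧ ⟪e.normal, C.axis⟫ = Real.sin C.angle := by
  have hs := C.sin_pos
  have hc := C.cos_pos
  have hsc := Real.sin_sq_add_cos_sq C.angle
  have ha : ⟪C.axis, C.axis⟫ = 1 := by rw [real_inner_self_eq_norm_sq, C.norm_axis]; norm_num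
  have hn : ⟪e.normal, e.normal⟫ = 1 := by
    rw [real_inner_self_eq_norm_sq, e.norm_normal]; norm_num
  refine and_congr_right fun _ => ⟨?_, fun h => ?_⟩
  · rintro ⟨g, ⟨_, hg⟩, he⟩
    rw [he, normalAlong, real_inner_smul_left, inner_sub_left, real_inner_smul_left, ha, hg]
    field_simp
    nlinarith
  · have h' : ⟪C.axis, e.normal⟫ = Real.sin C.angle := by rw [real_inner_comm]; exact h
    refine ⟨(Real.cos C.angle)⁻¹ • (C.axis - Real.sin C.angle • e.normal), ⟨?_, ?_⟩, ?_⟩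
    · have h1 : ‖C.axis - Real.sin C.angle • e.normal‖ ^ 2 = Real.cos C.angle ^ 2 := by
        rw [← real_inner_self_eq_norm_sq, inner_sub_left, inner_sub_right, inner_sub_right,
          real_inner_smul_left, real_inner_smul_left, real_inner_smul_right,
          real_inner_smul_right, ha, hn, h, h']
        nlinarith
      have h2 : ‖C.axis - Real.sin C.angle • e.normal‖ = Real.cos C.angle :=
        (pow_left_inj₀ (norm_nonneg _) hc.le two_ne_zero).1 h1
      rw [norm_smul, h2, Real.norm_eq_abs, abs_of_pos (inv_pos.2 hc)]
      field_simp
    · rw [real_inner_smul_left, inner_sub_left, real_inner_smul_left, ha, h]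
      field_simp
      nlinarith
    · rw [normalAlong, smul_inv_smul₀ hc.ne', sub_sub_cancel, inv_smul_smul₀ hs.ne']

/-- A plane in oriented contact touches the cone along a generator: the common points of
plane and cone are the points of a generator. -/
theorem points_inter_of_orientedContact (C : RevolutionCone) (e : OrientedPlane)
    (h : C.OrientedContact e) :
    ∃ g, C.IsGenerator g ∧ e.points ∩ C.points = {x | ∃ t : ℝ, x = C.apex + t • g} := by
  have hs := C.sin_pos
  have hc := C.cos_pos
  have hsc := Real.sin_sq_add_cos_sq C.angle
  obtain ⟨hp, g, ⟨hg1, hg⟩, he⟩ := h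
  have ha' : C.axis = Real.sin C.angle • e.normal + Real.cos C.angle • g := by
    rw [he, normalAlong, smul_inv_smul₀ hs.ne']; abel
  have hgg : ⟪g, g⟫ = 1 := by rw [real_inner_self_eq_norm_sq, hg1]; norm_num
  have hng : ⟪e.normal, g⟫ = 0 := by
    have h0 := hg
    rw [ha', inner_add_right, real_inner_smul_right, real_inner_smul_right, hgg,
      real_inner_comm] at h0
    have : Real.sin C.angle * ⟪e.normal, g⟫ = 0 := by linarith
    exact (mul_eq_zero.1 this).resolve_left hs.ne'
  have hp' : ⟪e.normal, C.apex⟫ = e.offset := hp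
  refine ⟨g, ⟨hg1, hg⟩, ?_⟩
  ext x
  constructor
  · rintro ⟨hx, hx'⟩
    have hx0 : ⟪e.normal, x⟫ = e.offset := hx
    have hy : ⟪x - C.apex, e.normal⟫ = 0 := by
      rw [real_inner_comm, inner_sub_right, hx0, hp', sub_self]
    have hx1 : ⟪x - C.apex, C.axis⟫ ^ 2 = Real.cos C.angle ^ 2 * ‖x - C.apex‖ ^ 2 := hx'
    rw [ha', inner_add_right, real_inner_smul_right, real_inner_smul_right, hy, mul_zero,
      zero_add, mul_pow] at hx1
    have hx2 := mul_left_cancel₀ (pow_ne_zero 2 hc.ne') hx1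
    refine ⟨⟪x - C.apex, g⟫, ?_⟩
    have : ‖x - C.apex - ⟪x - C.apex, g⟫ • g‖ ^ 2 = 0 := by
      rw [norm_sub_sq_real, real_inner_smul_right, norm_smul, hg1, mul_one, Real.norm_eq_abs,
        sq_abs, ← hx2]
      ring
    have h3 := norm_eq_zero.1 (pow_eq_zero_iff two_ne_zero |>.1 this)
    rw [← sub_eq_zero.1 h3]; abel
  · rintro ⟨t, rfl⟩
    refine ⟨?_, ?_⟩
    · change ⟪e.normal, C.apex + t • g⟫ = e.offset
      rw [inner_add_right, real_inner_smul_right, hng, hp']; ring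
    · change ⟪C.apex + t • g - C.apex, C.axis⟫ ^ 2 =
        Real.cos C.angle ^ 2 * ‖C.apex + t • g - C.apex‖ ^ 2
      rw [add_sub_cancel_left, real_inner_smul_left, hg, norm_smul, hg1, mul_one,
        Real.norm_eq_abs, sq_abs]
      ring

end RevolutionCone

/-- The locus of the oriented planes of the moving space whose homologous images are in oriented
contact with a common cone of revolution. -/
def conePlanes (α : Fin 4 → Space ≃ᵃⁱ[ℝ] Space) : Set OrientedPlane :=
  {e | ∃ C : RevolutionCone, ∀ i, C.OrientedContact (e.image (α i))}

/-- The pencil of parallel oriented planes (of both orientations) orthogonal to the line `l`. -/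
def orthogonalPencil (l : AffineSubspace ℝ Space) : Set OrientedPlane :=
  {e | e.normal ∈ l.direction}

/-- The homologous images of the line `l` are parallel to a common plane; in other words, the
homologous normals of the planes orthogonal to `l` span at most a two-dimensional space. -/
def HomologousParallelToPlane (α : Fin 4 → Space ≃ᵃⁱ[ℝ] Space)
    (l : AffineSubspace ℝ Space) : Prop :=
  ∃ n : Space, n ≠ 0 ∧ ∀ i, ∀ d ∈ l.direction, ⟪n, (α i).linearIsometryEquiv d⟫ = 0

/-- The four revolute axes and two further lines `u`, `v`. -/
def sixLines (α : Fin 4 → Space ≃ᵃⁱ[ℝ] Space) (u v : AffineSubspace ℝ Space) :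
    Fin 6 → AffineSubspace ℝ Space :=
  ![revoluteAxis α 0, revoluteAxis α 1, revoluteAxis α 2, revoluteAxis α 3, u, v]

/-!
Let `n` be the normal of the plane `e`, let `A i` be the linear part of `α i`, and let `u i` be a
direction of the axis `r_{i,i+1}`. Let `p i` and `a i` denote the preimages of the apex and of the
axis vector of a cone under `α i` and `A i`. By `RevolutionCone.orientedContact_iff`, oriented
contact with all four homologous planes means that the points `p i` lie in `e` and that the
products `⟪n, a i⟫` have a common value in the open interval `(0, 1)`.

*From cones to lines* (`exists_orthogonal_of_mem_conePlanes`). Assume that `n` is parallel to none of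
the axes. Since `α i` and `α (i + 1)` agree on `r_{i,i+1}`, this axis lies in a bisector plane of
`p i` and `p (i + 1)`, and as both points lie in `e`, its projection along `n` onto `e` is the
perpendicular bisector of `p i` and `p (i + 1)` in `e`. The same holds for the vectors `a i`. So the
projections of `p` and `a` are planar quadrilaterals with parallel sides, orthogonal to the same four
projected axes. The second one is inscribed in a circle. Having the same angles, the first one is
inscribed in a circle as well; its centre lies on all four bisectors, so the line through it in
direction `n` is a transversal. `inner_cross_add_eq_zero` gives the bisector property with
`cross n (u i)` as a normal of the projected axis, also if `p i = p (i + 1)`, and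
`exists_inner_eq_of_parallel_sides` replaces the argument with angles by linear algebra that covers
all degenerate quadrilaterals.

*From lines to cones* (`mem_conePlanes_of_relation`). Apex and axis of a cone are found from linear
systems with the rows `A i n`. If these rows span space, then the systems are solvable as soon as one
nontrivial relation between the rows extends to the right hand sides. For the planes orthogonal to
`r_{i,i+1}`, such a relation is `A i n = A (i + 1) n`; for those orthogonal to a transversal it is the
closing condition of a polygon (`IsTransversal.exists_relation`).

*Disjointness.* Parallel axes, or a transversal parallel to an axis, contradict genericity, and
parallel transversals are never isolated (`not_parallel_axes`, `not_parallel_axis_transversal`,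
`not_parallel_transversals`).
-/

/-! ### The cross product of Euclidean three-space -/

/-- The cross product, on `Space` instead of on `Fin 3 → ℝ`. -/
noncomputable def cross (a b : Space) : Space :=
  !₂[a 1 * b 2 - a 2 * b 1, a 2 * b 0 - a 0 * b 2, a 0 * b 1 - a 1 * b 0]

theorem inner_eq_sum (a b : Space) : ⟪a, b⟫ = a 0 * b 0 + a 1 * b 1 + a 2 * b 2 := by
  simp [PiLp.inner_apply, Fin.sum_univ_three]
  ring

theorem inner_cross_rotate (n u a : Space) : ⟪cross n u, a⟫ = ⟪u, cross a n⟫ := by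
  simp [inner_eq_sum, cross]
  ring

theorem inner_cross_left (n u : Space) : ⟪cross n u, n⟫ = 0 := by
  simp [inner_eq_sum, cross]
  ring

theorem inner_cross_right (n u : Space) : ⟪cross n u, u⟫ = 0 := by
  simp [inner_eq_sum, cross]
  ring

/-- Three vectors orthogonal to a common nonzero vector are linearly dependent. -/
theorem inner_cross_eq_zero {n u x d : Space} (hd : d ≠ 0) (hn : ⟪n, d⟫ = 0) (hu : ⟪u, d⟫ = 0)
    (hx : ⟪x, d⟫ = 0) : ⟪cross n u, x⟫ = 0 := by
  by_contra h
  apply hd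
  rw [inner_eq_sum] at hn hu hx h
  simp only [cross, PiLp.toLp_apply, Matrix.cons_val] at h
  ext j
  refine (mul_eq_zero.1 (?_ : _ * d j = 0)).resolve_left h
  -- Cramer's rule for the homogeneous system `hn`, `hu`, `hx` in the coordinates of `d`
  fin_cases j <;> simp only [Fin.zero_eta, Fin.mk_one, Fin.reduceFinMk]
  · linear_combination (u 1 * x 2 - u 2 * x 1) * hn + (x 1 * n 2 - x 2 * n 1) * hu +
      (n 1 * u 2 - n 2 * u 1) * hx
  · linear_combination (u 2 * x 0 - u 0 * x 2) * hn + (x 2 * n 0 - x 0 * n 2) * hu +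
      (n 2 * u 0 - n 0 * u 2) * hx
  · linear_combination (u 0 * x 1 - u 1 * x 0) * hn + (x 0 * n 1 - x 1 * n 0) * hu +
      (n 0 * u 1 - n 1 * u 0) * hx

/-- Expansion of a vector in the frame `n`, `u`, `cross n u`. -/
theorem inner_cross_self_smul (n u x : Space) :
    ⟪cross n u, cross n u⟫ • x = ⟪x, cross u (cross n u)⟫ • n + ⟪x, cross (cross n u) n⟫ • u +
      ⟪x, cross n u⟫ • cross n u := by
  simp only [inner_eq_sum]
  ext j
  fin_cases j <;> simp [cross] <;> ring

theorem exists_eq_smul_cross {n u x : Space} (hc : cross n u ≠ 0) (hn : ⟪n, x⟫ = 0)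
    (hu : ⟪u, x⟫ = 0) : ∃ r : ℝ, x = r • cross n u := by
  set c := cross n u with hcdef
  have hcc : ⟪c, c⟫ ≠ 0 := inner_self_ne_zero.2 hc
  refine ⟨⟪c, x⟫ / ⟪c, c⟫, ?_⟩
  by_contra h
  refine hcc (inner_cross_eq_zero (d := x - (⟪c, x⟫ / ⟪c, c⟫) • c) (sub_ne_zero.2 h) ?_ ?_ ?_)
  · rw [inner_sub_right, inner_smul_right, hn, real_inner_comm c n, hcdef, inner_cross_left,
      mul_zero, sub_zero]
  · rw [inner_sub_right, inner_smul_right, hu, real_inner_comm c u, hcdef, inner_cross_right,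
      mul_zero, sub_zero]
  · rw [inner_sub_right, inner_smul_right]
    field_simp
    ring

theorem exists_eq_smul_add_smul {n u x : Space} (hc : cross n u ≠ 0) (hx : ⟪cross n u, x⟫ = 0) :
    ∃ s t : ℝ, x = s • n + t • u := by
  have hcc : ⟪cross n u, cross n u⟫ ≠ 0 := inner_self_ne_zero.2 hc
  have h := inner_cross_self_smul n u x
  rw [real_inner_comm] at hx
  rw [hx, zero_smul, add_zero] at h
  refine ⟨⟪cross n u, cross n u⟫⁻¹ * ⟪x, cross u (cross n u)⟫,
    ⟪cross n u, cross n u⟫⁻¹ * ⟪x, cross (cross n u) n⟫, ?_⟩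
  rw [mul_smul, mul_smul, ← smul_add, ← h, inv_smul_smul₀ hcc]

theorem eq_smul_of_cross_eq_zero {n u : Space} (hn : ‖n‖ = 1) (h : cross n u = 0) :
    u = ⟪n, u⟫ • n := by
  have h1 : ⟪n, n⟫ = 1 := by rw [real_inner_self_eq_norm_sq, hn, one_pow]
  have h0 : n 1 * u 2 - n 2 * u 1 = 0 := by simpa [cross] using congrArg (fun x : Space => x 0) h
  have h2 : n 2 * u 0 - n 0 * u 2 = 0 := by simpa [cross] using congrArg (fun x : Space => x 1) h
  have h3 : n 0 * u 1 - n 1 * u 0 = 0 := by simpa [cross] using congrArg (fun x : Space => x 2) h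
  rw [inner_eq_sum] at h1
  ext j
  rw [inner_eq_sum]
  fin_cases j <;> simp only [Fin.zero_eta, Fin.mk_one, Fin.reduceFinMk, PiLp.smul_apply, smul_eq_mul]
  · linear_combination -u 0 * h1 - n 1 * h3 + n 2 * h2
  · linear_combination -u 1 * h1 + n 0 * h3 - n 2 * h0
  · linear_combination -u 2 * h1 - n 0 * h2 + n 1 * h0

/-! ### Linear systems of four equations -/

/-- The linear forms `⟪v i, ·⟫` combined to a map into `ℝ⁴`. -/
noncomputable def innerMap (v : Fin 4 → Space) : Space →ₗ[ℝ] EuclideanSpace ℝ (Fin 4) where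
  toFun x := WithLp.toLp 2 fun i => ⟪v i, x⟫
  map_add' x y := by ext i; simp [inner_add_right]
  map_smul' c x := by ext i; simp [inner_smul_right]

theorem innerMap_apply (v : Fin 4 → Space) (x : Space) (i : Fin 4) :
    innerMap v x i = ⟪v i, x⟫ := rfl

theorem inner_innerMap (v : Fin 4 → Space) (w : EuclideanSpace ℝ (Fin 4)) (x : Space) :
    ⟪w, innerMap v x⟫ = ⟪∑ i, w i • v i, x⟫ := by
  simp [PiLp.inner_apply, sum_inner, inner_smul_left, innerMap_apply, mul_comm]

/-- A system `⟪v i, y⟫ = f i` is solvable if `f` satisfies a complete set `W` of linear relations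
between the `v i`. -/
theorem exists_inner_eq (v : Fin 4 → Space) (W : Submodule ℝ (EuclideanSpace ℝ (Fin 4)))
    (hW : ∀ w ∈ W, ∑ i, w i • v i = 0)
    (hdim : 1 + Module.finrank ℝ (innerMap v).ker ≤ Module.finrank ℝ W)
    (f : EuclideanSpace ℝ (Fin 4)) (hf : ∀ w ∈ W, ⟪w, f⟫ = 0) : ∃ y, ∀ i, ⟪v i, y⟫ = f i := by
  have hle : W ≤ (innerMap v).rangeᗮ := by
    intro w hw
    rw [Submodule.mem_orthogonal']
    rintro _ ⟨x, rfl⟩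
    rw [inner_innerMap, hW w hw, inner_zero_left]
  have h1 := (innerMap v).finrank_range_add_finrank_ker
  have h2 := (innerMap v).range.finrank_add_finrank_orthogonal
  rw [finrank_euclideanSpace_fin] at h1 h2
  have heq : W = (innerMap v).rangeᗮ := Submodule.eq_of_le_of_finrank_le hle (by omega)
  have hf' : f ∈ (innerMap v).range := by
    rw [← Submodule.orthogonal_orthogonal (innerMap v).range, ← heq, Submodule.mem_orthogonal]
    exact hf
  obtain ⟨y, rfl⟩ := hf'
  exact ⟨y, fun i => rfl⟩

/-! ### Lines and revolute axes -/

theorem IsLine.exists_direction_eq_span {l : AffineSubspace ℝ Space} (hl : IsLine l) :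
    ∃ u : Space, u ≠ 0 ∧ l.direction = ℝ ∙ u := by
  obtain ⟨u, hu, h⟩ := finrank_eq_one_iff'.1 hl.2
  refine ⟨u, fun h0 => hu (Subtype.ext h0), le_antisymm (fun x hx => ?_) ?_⟩
  · obtain ⟨c, hc⟩ := h ⟨x, hx⟩
    exact Submodule.mem_span_singleton.2 ⟨c, congrArg Subtype.val hc⟩
  · rw [Submodule.span_singleton_le_iff_mem]
    exact u.2

theorem isLine_mk' (y : Space) {n : Space} (hn : n ≠ 0) :
    IsLine (AffineSubspace.mk' y (ℝ ∙ n)) :=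
  ⟨⟨y, AffineSubspace.self_mem_mk' y _⟩, by
    rw [AffineSubspace.direction_mk', finrank_span_singleton hn]⟩

theorem IsLine.direction_eq_span {l : AffineSubspace ℝ Space} (hl : IsLine l) {n : Space}
    (hn : n ∈ l.direction) (hn0 : n ≠ 0) : l.direction = ℝ ∙ n := by
  have : FiniteDimensional ℝ l.direction := Module.finite_of_finrank_eq_succ hl.2
  refine (Submodule.eq_of_le_of_finrank_eq ?_ ?_).symm
  · rwa [Submodule.span_singleton_le_iff_mem]
  · rw [hl.2, finrank_span_singleton hn0]

theorem map_sub_map (τ : Space ≃ᵃⁱ[ℝ] Space) (x y : Space) :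
    τ x - τ y = τ.linearIsometryEquiv (x - y) :=
  (τ.map_vsub x y).symm

theorem mem_direction_revoluteAxis {α : Fin 4 → Space ≃ᵃⁱ[ℝ] Space} {i : Fin 4} {z : Space}
    (hz : z ∈ revoluteAxis α i) (d : Space) :
    d ∈ (revoluteAxis α i).direction ↔
      (α i).linearIsometryEquiv d = (α (i + 1)).linearIsometryEquiv d := by
  rw [← AffineSubspace.vadd_mem_iff_mem_direction d hz, mem_revoluteAxis,
    AffineIsometryEquiv.map_vadd, AffineIsometryEquiv.map_vadd, (mem_revoluteAxis α i z).1 hz]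
  exact vadd_right_cancel_iff _

theorem IsRotationQuadrangle.isLine_revoluteAxis {α : Fin 4 → Space ≃ᵃⁱ[ℝ] Space}
    (hα : IsRotationQuadrangle α) (i : Fin 4) : IsLine (revoluteAxis α i) := by
  obtain ⟨-, l, hl, hmem⟩ := hα.2 i
  have hmap : revoluteAxis α i = l.map ((α i).symm.toAffineEquiv : Space →ᵃ[ℝ] Space) := by
    ext x
    rw [mem_revoluteAxis_iff_fixed, hmem, AffineSubspace.mem_map]
    constructor
    · exact fun h => ⟨α i x, h, (α i).symm_apply_apply x⟩
    · rintro ⟨y, hy, rfl⟩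
      have : α i ((α i).symm y) = y := (α i).apply_symm_apply y
      exact this.symm ▸ hy
  rw [hmap]
  refine ⟨?_, ?_⟩
  · rw [AffineSubspace.coe_map]
    exact hl.1.image _
  · rw [AffineSubspace.map_direction]
    exact (LinearEquiv.finrank_map_eq (α i).symm.linearIsometryEquiv.toLinearEquiv _).trans hl.2

theorem mem_orthogonalPencil {l : AffineSubspace ℝ Space} {e : OrientedPlane} :
    e ∈ orthogonalPencil l ↔ e.normal ∈ l.direction := Iff.rfl

theorem eq_apply_zero_of_step {f : Fin 4 → Space} (h : ∀ i, f i = f (i + 1)) (i : Fin 4) :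
    f i = f 0 := by
  have h0 := h 0
  have h1 := h 1
  have h2 := h 2
  simp only [Fin.reduceAdd] at h0 h1 h2
  fin_cases i
  · rfl
  · exact h0.symm
  · exact (h0.trans h1).symm
  · exact (h0.trans (h1.trans h2)).symm

/-! ### Transversals from cones -/

/-- If two isometries agree exactly on the line spanned by `u` and map `x` and `x'` to the same
vector, then `x - x'` is orthogonal to `u`; if it is orthogonal to `n` as well, then the
midpoint of `x` and `x'` lies in the plane spanned by `n` and `u`. The reason for the latter is that
`n`, `u` and `x + x'` are all orthogonal to `x - x'`, as `x` and `x'` have the same norm. -/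
theorem inner_cross_add_eq_zero {A B : Space ≃ₗᵢ[ℝ] Space} {u n x x' : Space}
    (hAB : ∀ d, A d = B d ↔ d ∈ ℝ ∙ u) (hx : A x = B x') (hn : ⟪n, x - x'⟫ = 0) :
    ⟪u, x - x'⟫ = 0 ∧ ⟪cross n u, x + x'⟫ = 0 := by
  have hu : ⟪u, x - x'⟫ = 0 := by
    rw [inner_sub_right, ← A.inner_map_map u x, ← B.inner_map_map u x', hx,
      (hAB u).2 (Submodule.mem_span_singleton_self u), sub_self]
  refine ⟨hu, ?_⟩
  have hnorm : ‖x‖ = ‖x'‖ := by rw [← A.norm_map x, hx, B.norm_map]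
  by_cases h : x = x'
  · subst h
    obtain ⟨t, rfl⟩ := Submodule.mem_span_singleton.1 ((hAB x).1 hx)
    rw [inner_add_right, inner_smul_right, inner_cross_right, mul_zero, add_zero]
  · refine inner_cross_eq_zero (sub_ne_zero.2 h) hn hu ?_
    rw [inner_sub_right, inner_add_left, inner_add_left, real_inner_comm x x',
      real_inner_self_eq_norm_sq, real_inner_self_eq_norm_sq, hnorm]
    ring

/-- Let `p` and `a` be closed quadrilaterals whose corresponding sides are both parallel to `v i`,
and assume that the midpoints of the sides of `a` are orthogonal to the `v i`, so that the
perpendicular bisectors of these sides pass through the origin. Then the perpendicular bisectors of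
the sides of `p` have a common point `y` as well.

The conditions on `y` form a linear system, solvable if the right hand sides satisfy all linear
relations between the `v i`. Each quadrilateral closes and hence gives such a relation. The two
relations form a complete set unless they are proportional, and then `p` is a homothetic image of
`a`. -/
theorem exists_inner_eq_of_parallel_sides {v p a : Fin 4 → Space} {r s : Fin 4 → ℝ} {n : Space}
    (hv : ∀ b, (∀ i, ⟪v i, b⟫ = 0) → b ∈ ℝ ∙ n)
    (hp : ∀ i, p i - p (i + 1) = r i • v i) (ha : ∀ i, a i - a (i + 1) = s i • v i)
    (hva : ∀ i, ⟪v i, a i + a (i + 1)⟫ = 0) (hs : s ≠ 0) :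
    ∃ y, ∀ i, ⟪v i, y⟫ = ⟪v i, p i + p (i + 1)⟫ / 2 := by
  by_cases hli : LinearIndependent ℝ
      ![WithLp.toLp 2 s, (WithLp.toLp 2 r : EuclideanSpace ℝ (Fin 4))]
  · have hs0 : ∑ i, s i • v i = 0 := by
      simp only [← ha, Fin.sum_univ_four, Fin.reduceAdd]
      abel
    have hr0 : ∑ i, r i • v i = 0 := by
      simp only [← hp, Fin.sum_univ_four, Fin.reduceAdd]
      abel
    -- both relations extend to the right hand sides of the system
    have hsf : ∑ i, ⟪s i • v i, p i + p (i + 1)⟫ = 0 := by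
      -- the sum is the negative of `∑ i, ⟪p i - p (i + 1), a i + a (i + 1)⟫`
      have h0 : ∑ i, ⟪p i - p (i + 1), a i + a (i + 1)⟫ = 0 := by
        simp [hp, inner_smul_left, hva]
      simp only [← ha]
      simp only [Fin.sum_univ_four, Fin.reduceAdd, inner_sub_left, inner_add_right] at h0 ⊢
      simp only [real_inner_comm (a _) (p _)] at h0
      linarith
    have hrf : ∑ i, ⟪r i • v i, p i + p (i + 1)⟫ = 0 := by
      simp only [← hp]
      simp only [Fin.sum_univ_four, Fin.reduceAdd, inner_sub_left, inner_add_right]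
      rw [real_inner_comm (p 0) (p 1), real_inner_comm (p 1) (p 2), real_inner_comm (p 2) (p 3),
        real_inner_comm (p 3) (p 0)]
      ring
    refine exists_inner_eq v (Submodule.span ℝ (Set.range
      ![WithLp.toLp 2 s, (WithLp.toLp 2 r : EuclideanSpace ℝ (Fin 4))])) ?_ ?_
      (WithLp.toLp 2 fun i => ⟪v i, p i + p (i + 1)⟫ / 2) ?_
    · intro w hw
      rw [Matrix.range_cons_cons_empty, Submodule.mem_span_pair] at hw
      obtain ⟨b, c, rfl⟩ := hw
      simp only [PiLp.add_apply, PiLp.smul_apply, smul_eq_mul, add_smul, mul_smul,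
        Finset.sum_add_distrib, ← Finset.smul_sum, hs0, hr0, smul_zero, add_zero]
    · rw [finrank_span_eq_card hli, Fintype.card_fin]
      have hker : (innerMap v).ker ≤ ℝ ∙ n := by
        intro b hb
        refine hv b fun i => ?_
        rw [← innerMap_apply, LinearMap.mem_ker.1 hb]
        rfl
      have h1 := Submodule.finrank_mono hker
      have h2 := finrank_span_le_card (R := ℝ) ({n} : Set Space)
      simp only [Set.toFinset_singleton, Finset.card_singleton] at h2
      omega
    · intro w hw
      rw [Matrix.range_cons_cons_empty, Submodule.mem_span_pair] at hw
      obtain ⟨b, c, rfl⟩ := hw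
      simp only [inner_smul_left] at hsf hrf
      simp only [PiLp.inner_apply, PiLp.add_apply, PiLp.smul_apply, smul_eq_mul,
        Fin.sum_univ_four, RCLike.inner_apply, conj_trivial] at hsf hrf ⊢
      linear_combination (b / 2) * hsf + (c / 2) * hrf
  · rw [LinearIndependent.pair_iff' (fun h => hs (congrArg WithLp.ofLp h))] at hli
    push Not at hli
    obtain ⟨k, hk⟩ := hli
    have hk' : ∀ i, r i = k * s i := fun i =>
      (congrArg (fun x : EuclideanSpace ℝ (Fin 4) => x i) hk).symm
    -- `p - k • a` is constant, and its value is the common point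
    have hstep : ∀ i, p i - k • a i = p (i + 1) - k • a (i + 1) := by
      intro i
      have h := hp i
      rw [hk', mul_smul, ← ha] at h
      linear_combination (norm := module) h
    have hconst : ∀ i, p i - k • a i = p 0 - k • a 0 :=
      eq_apply_zero_of_step (f := fun i => p i - k • a i) hstep
    refine ⟨p 0 - k • a 0, fun i => ?_⟩
    have h1 : ⟪v i, p 0 - k • a 0⟫ = ⟪v i, p i⟫ - k * ⟪v i, a i⟫ := by
      rw [← hconst i, inner_sub_right, inner_smul_right]
    have h2 : ⟪v i, p 0 - k • a 0⟫ = ⟪v i, p (i + 1)⟫ - k * ⟪v i, a (i + 1)⟫ := by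
      rw [← hconst (i + 1), inner_sub_right, inner_smul_right]
    have h3 := hva i
    rw [inner_add_right] at h3 ⊢
    linear_combination (1 / 2) * h1 + (1 / 2) * h2 - (k / 2) * h3

/-- A solution plane is orthogonal to a revolute axis or to a transversal. -/
theorem exists_orthogonal_of_mem_conePlanes {α : Fin 4 → Space ≃ᵃⁱ[ℝ] Space}
    (hα : IsRotationQuadrangle α)
    (hplane : ¬ ∃ n : Space, n ≠ 0 ∧ ∀ i, ∀ d ∈ (revoluteAxis α i).direction, ⟪n, d⟫ = 0)
    {e : OrientedPlane} (he : e ∈ conePlanes α) :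
    (∃ i, e ∈ orthogonalPencil (revoluteAxis α i)) ∨
      ∃ l, IsTransversal α l ∧ e ∈ orthogonalPencil l := by
  rw [or_iff_not_imp_left]
  intro hnot
  push Not at hnot
  obtain ⟨C, hC⟩ := he
  set n := e.normal with hn
  have hn1 : ‖n‖ = 1 := e.norm_normal
  have hn0 : n ≠ 0 := norm_ne_zero_iff.1 (by rw [hn1]; exact one_ne_zero)
  choose z hz using fun i => (hα.isLine_revoluteAxis i).1
  choose u hu0 hu using fun i => (hα.isLine_revoluteAxis i).exists_direction_eq_span
  have hAB : ∀ i d, (α i).linearIsometryEquiv d = (α (i + 1)).linearIsometryEquiv d ↔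
      d ∈ ℝ ∙ u i := fun i d => by rw [← hu, mem_direction_revoluteAxis (hz i)]
  have hv0 : ∀ i, cross n (u i) ≠ 0 := by
    intro i h
    apply hnot i
    have h1 := eq_smul_of_cross_eq_zero hn1 h
    have h2 : ⟪n, u i⟫ ≠ 0 := fun h0 => hu0 i (by rw [h1, h0, zero_smul])
    rw [mem_orthogonalPencil, hu, Submodule.mem_span_singleton]
    exact ⟨⟪n, u i⟫⁻¹, by rw [h1, ← h1, inv_smul_eq_iff₀ h2, ← h1]⟩
  have hv : ∀ b, (∀ i, ⟪cross n (u i), b⟫ = 0) → b ∈ ℝ ∙ n := by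
    intro b hb
    rw [Submodule.mem_span_singleton]
    refine ⟨⟪n, b⟫, (eq_smul_of_cross_eq_zero hn1 ?_).symm⟩
    by_contra hc
    refine hplane ⟨cross n b, hc, fun i d hd => ?_⟩
    rw [hu, Submodule.mem_span_singleton] at hd
    obtain ⟨t, rfl⟩ := hd
    have h1 := hb i
    rw [inner_cross_rotate, inner_eq_sum] at h1
    rw [inner_smul_right, inner_eq_sum]
    simp only [cross, PiLp.toLp_apply, Matrix.cons_val] at h1 ⊢
    linear_combination -t * h1
  -- the apex and the axis of the cone, seen from the moving space
  let p : Fin 4 → Space := fun i => (α i).symm C.apex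
  let a : Fin 4 → Space := fun i => (α i).linearIsometryEquiv.symm C.axis
  have hαp : ∀ i, α i (p i) = C.apex := fun i => (α i).apply_symm_apply _
  have hAa : ∀ i, (α i).linearIsometryEquiv (a i) = C.axis := fun i =>
    LinearIsometryEquiv.apply_symm_apply _ _
  have hnp : ∀ i, ⟪n, p i⟫ = e.offset := by
    intro i
    have h := (C.orientedContact_iff _).1 (hC i) |>.1
    rw [← hαp i, OrientedPlane.mem_points_image] at h
    exact h
  have hna : ∀ i, ⟪n, a i⟫ = Real.sin C.angle := by
    intro i
    have h := (C.orientedContact_iff _).1 (hC i) |>.2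
    rw [← hAa i] at h
    rw [← h]
    exact ((α i).linearIsometryEquiv.inner_map_map _ _).symm
  have hA : ∀ i, ⟪u i, a i - a (i + 1)⟫ = 0 ∧ ⟪cross n (u i), a i + a (i + 1)⟫ = 0 := fun i =>
    inner_cross_add_eq_zero (hAB i) ((hAa i).trans (hAa (i + 1)).symm)
      (by rw [inner_sub_right, hna, hna, sub_self])
  have hP : ∀ i, ⟪u i, (p i - z i) - (p (i + 1) - z i)⟫ = 0 ∧
      ⟪cross n (u i), (p i - z i) + (p (i + 1) - z i)⟫ = 0 := fun i =>
    inner_cross_add_eq_zero (hAB i)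
      (by rw [← map_sub_map, ← map_sub_map, hαp, hαp, (mem_revoluteAxis α i _).1 (hz i)])
      (by rw [sub_sub_sub_cancel_right, inner_sub_right, hnp, hnp, sub_self])
  choose s hs using fun i => exists_eq_smul_cross (hv0 i)
    (show ⟪n, a i - a (i + 1)⟫ = 0 by rw [inner_sub_right, hna, hna, sub_self]) (hA i).1
  choose r hr using fun i => exists_eq_smul_cross (hv0 i)
    (show ⟪n, p i - p (i + 1)⟫ = 0 by rw [inner_sub_right, hnp, hnp, sub_self])
    (by have h := (hP i).1; rwa [sub_sub_sub_cancel_right] at h)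
  have hs0 : s ≠ 0 := by
    -- otherwise the axis would have constant direction `a 0 = ± n`, which the angle excludes
    rintro rfl
    have hstep : ∀ i, a i = a (i + 1) := fun i => by
      rw [← sub_eq_zero, hs, Pi.zero_apply, zero_smul]
    have hmem : ∀ i, ⟪cross n (u i), a i⟫ = 0 := by
      intro i
      have h := (hA i).2
      rw [← hstep, inner_add_right] at h
      linarith
    have hconst : ∀ i, a i = a 0 := eq_apply_zero_of_step hstep
    obtain ⟨t, ht⟩ := Submodule.mem_span_singleton.1 (hv (a 0) fun i => hconst i ▸ hmem i)
    have h1 : t = Real.sin C.angle := by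
      rw [← hna 0, ← ht, inner_smul_right, real_inner_self_eq_norm_sq, hn1]
      ring
    have h2 : |t| = 1 := by
      have h3 : ‖a 0‖ = 1 := by
        rw [← LinearIsometryEquiv.norm_map (α 0).linearIsometryEquiv, hAa, C.norm_axis]
      rwa [← ht, norm_smul, hn1, mul_one, Real.norm_eq_abs] at h3
    rw [h1, abs_of_pos C.sin_pos] at h2
    have h4 := Real.sin_sq_add_cos_sq C.angle
    rw [h2] at h4
    have h5 := C.cos_pos
    nlinarith
  obtain ⟨y, hy⟩ := exists_inner_eq_of_parallel_sides hv hr hs (fun i => (hA i).2) hs0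
  refine ⟨AffineSubspace.mk' y (ℝ ∙ n), ⟨isLine_mk' y hn0, fun i => ?_⟩, ?_⟩
  · have h1 : ⟪cross n (u i), y - z i⟫ = 0 := by
      have h2 := (hP i).2
      rw [inner_add_right, inner_sub_right, inner_sub_right] at h2
      rw [inner_sub_right, hy, inner_add_right]
      linarith
    obtain ⟨b, c, hbc⟩ := exists_eq_smul_add_smul (hv0 i) h1
    refine ⟨c • u i +ᵥ z i, ?_, ?_⟩
    · rw [AffineSubspace.mem_mk', Submodule.mem_span_singleton]
      refine ⟨-b, ?_⟩
      rw [vsub_eq_sub, vadd_eq_add, eq_add_of_sub_eq hbc, neg_smul]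
      abel
    · rw [AffineSubspace.vadd_mem_iff_mem_direction _ (hz i), hu]
      exact Submodule.smul_mem _ _ (Submodule.mem_span_singleton_self _)
  · rw [mem_orthogonalPencil, AffineSubspace.direction_mk']
    exact Submodule.mem_span_singleton_self n

/-! ### Cones from linear relations between the homologous normals -/

theorem exists_ne_zero_inner_eq_zero (a b : Space) :
    ∃ m : Space, m ≠ 0 ∧ ⟪m, a⟫ = 0 ∧ ⟪m, b⟫ = 0 := by
  have h1 : Module.finrank ℝ (Submodule.span ℝ {a, b}) ≤ 2 := by
    classical
    refine (finrank_span_le_card _).trans ?_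
    rw [Set.toFinset_insert, Set.toFinset_singleton]
    exact Finset.card_le_two
  have h2 := (Submodule.span ℝ {a, b}).finrank_add_finrank_orthogonal
  rw [finrank_euclideanSpace_fin] at h2
  obtain ⟨m, hm, hm0⟩ := Submodule.exists_mem_ne_zero_of_ne_bot
    (show (Submodule.span ℝ {a, b})ᗮ ≠ ⊥ by
      intro h
      rw [h, finrank_bot] at h2
      omega)
  rw [Submodule.mem_orthogonal'] at hm
  exact ⟨m, hm0, hm a (Submodule.subset_span (by simp)), hm b (Submodule.subset_span (by simp))⟩

/-- If the homologous normals span space, then the linear systems for the cone axis (right hand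
side constantly one) and for the apex (right hand side the offsets) are solvable as soon as a
nontrivial relation between the normals extends to both right hand sides. -/
theorem mem_conePlanes_of_relation {α : Fin 4 → Space ≃ᵃⁱ[ℝ] Space} {e : OrientedPlane}
    (hspan : ¬ ∃ m : Space, m ≠ 0 ∧ ∀ i, ⟪m, (α i).linearIsometryEquiv e.normal⟫ = 0)
    {w : Fin 4 → ℝ} (hw : w ≠ 0) (hw1 : ∑ i, w i = 0)
    (hwn : ∑ i, w i • (α i).linearIsometryEquiv e.normal = 0)
    (hwo : ∑ i, w i * ⟪(α i).linearIsometryEquiv e.normal, α i 0⟫ = 0) : e ∈ conePlanes α := by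
  have hw' : (WithLp.toLp 2 w : EuclideanSpace ℝ (Fin 4)) ≠ 0 := fun h =>
    hw (congrArg WithLp.ofLp h)
  set N : Fin 4 → Space := fun i => (α i).linearIsometryEquiv e.normal with hN
  -- the relations between the rows `N i` are the multiples of `w`
  have hsolve : ∀ f : Fin 4 → ℝ, ∑ i, w i * f i = 0 → ∃ y, ∀ i, ⟪N i, y⟫ = f i := by
    intro f hf
    refine exists_inner_eq N (ℝ ∙ (WithLp.toLp 2 w : EuclideanSpace ℝ (Fin 4))) ?_ ?_
      (WithLp.toLp 2 f) ?_
    · intro w' hw'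
      obtain ⟨t, rfl⟩ := Submodule.mem_span_singleton.1 hw'
      simp only [PiLp.smul_apply, smul_assoc, ← Finset.smul_sum, hN, hwn, smul_zero]
    · have hker : (innerMap N).ker = ⊥ := by
        refine (Submodule.eq_bot_iff _).2 fun m hm => ?_
        by_contra h0
        refine hspan ⟨m, h0, fun i => ?_⟩
        rw [real_inner_comm]
        exact congrArg (fun x : EuclideanSpace ℝ (Fin 4) => x i) (LinearMap.mem_ker.1 hm)
      rw [hker, finrank_bot, finrank_span_singleton hw']
    · intro w' hw'
      obtain ⟨t, rfl⟩ := Submodule.mem_span_singleton.1 hw'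
      rw [inner_smul_left]
      simp only [PiLp.inner_apply, RCLike.inner_apply, conj_trivial]
      rw [← hf]
      simp [mul_comm, hf]
  obtain ⟨p, hp⟩ := hsolve (fun i => e.offset + ⟪N i, α i 0⟫) (by
    simp only [mul_add, Finset.sum_add_distrib, ← Finset.sum_mul, hw1, zero_mul, zero_add]
    exact hwo)
  obtain ⟨a, ha⟩ := hsolve (fun _ => 1) (by simpa using hw1)
  have hN1 : ∀ i, ‖N i‖ = 1 := fun i => by
    rw [hN, LinearIsometryEquiv.norm_map, e.norm_normal]
  -- the cone axis is `a`, normalized; its angle has sine `‖a‖⁻¹`, which must be less than `1`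
  have ha1 : 1 < ‖a‖ := by
    have h1 : 1 ≤ ‖a‖ := by
      have h := real_inner_le_norm (N 0) a
      rwa [ha, hN1, one_mul] at h
    refine lt_of_le_of_ne h1 fun h => hspan ?_
    obtain ⟨m, hm0, hm, -⟩ := exists_ne_zero_inner_eq_zero a a
    refine ⟨m, hm0, fun i => ?_⟩
    rwa [show (α i).linearIsometryEquiv e.normal = a from
      (inner_eq_one_iff_of_norm_eq_one (𝕜 := ℝ) (hN1 i) h.symm).1 (ha i)]
  have hpos : 0 < ‖a‖ := one_pos.trans ha1
  have hlt : ‖a‖⁻¹ < 1 := inv_lt_one_of_one_lt₀ ha1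
  refine ⟨⟨p, ‖a‖⁻¹ • a, Real.arcsin ‖a‖⁻¹, ?_, Real.arcsin_pos.2 (inv_pos.2 hpos),
    Real.arcsin_lt_pi_div_two.2 hlt⟩, fun i => ?_⟩
  · rw [norm_smul, norm_inv, norm_norm, inv_mul_cancel₀ hpos.ne']
  · rw [RevolutionCone.orientedContact_iff]
    refine ⟨hp i, ?_⟩
    rw [Real.sin_arcsin (by linarith [inv_pos.2 hpos]) hlt.le, inner_smul_right]
    exact (congrArg _ (ha i)).trans (mul_one _)

theorem homologousParallelToPlane_of_inner_eq_zero {α : Fin 4 → Space ≃ᵃⁱ[ℝ] Space}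
    {l : AffineSubspace ℝ Space} (hl : IsLine l) {n : Space} (hn : n ∈ l.direction) (hn0 : n ≠ 0)
    (h : ∃ m : Space, m ≠ 0 ∧ ∀ i, ⟪m, (α i).linearIsometryEquiv n⟫ = 0) :
    HomologousParallelToPlane α l := by
  obtain ⟨m, hm0, hm⟩ := h
  refine ⟨m, hm0, fun i d hd => ?_⟩
  rw [hl.direction_eq_span hn hn0] at hd
  obtain ⟨t, rfl⟩ := Submodule.mem_span_singleton.1 hd
  rw [map_smul, inner_smul_right, hm, mul_zero]

theorem OrientedPlane.normal_ne_zero (e : OrientedPlane) : e.normal ≠ 0 :=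
  norm_ne_zero_iff.1 (by rw [e.norm_normal]; exact one_ne_zero)

/-- The planes orthogonal to the axis `r_{i,i+1}` are solutions because their images under `α i`
and `α (i + 1)` coincide. -/
theorem mem_conePlanes_of_axis {α : Fin 4 → Space ≃ᵃⁱ[ℝ] Space} (hα : IsRotationQuadrangle α)
    {i : Fin 4} (haxis : ¬ HomologousParallelToPlane α (revoluteAxis α i)) {e : OrientedPlane}
    (he : e ∈ orthogonalPencil (revoluteAxis α i)) : e ∈ conePlanes α := by
  have hl := hα.isLine_revoluteAxis i
  rw [mem_orthogonalPencil] at he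
  obtain ⟨z, hz⟩ := hl.1
  have hii : i ≠ i + 1 := by fin_cases i <;> decide
  have hA := (mem_direction_revoluteAxis hz _).1 he
  have hoff : ∀ k, ⟪(α k).linearIsometryEquiv e.normal, α k 0⟫ =
      ⟪(α k).linearIsometryEquiv e.normal, α k z⟫ - ⟪e.normal, z⟫ := by
    intro k
    have h := map_sub_map (α k) z 0
    rw [sub_zero] at h
    rw [← sub_sub_self (α k z) (α k 0), h, inner_sub_right, LinearIsometryEquiv.inner_map_map]
  refine mem_conePlanes_of_relation
    (fun h => haxis (homologousParallelToPlane_of_inner_eq_zero hl he e.normal_ne_zero h))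
    (w := Pi.single i 1 - Pi.single (i + 1) 1) ?_ ?_ ?_ ?_
  · intro h
    have := congrFun h i
    simp [hii] at this
  · simp
  · simp [sub_smul, Finset.sum_sub_distrib, Pi.single_apply, hA]
  · simp only [hoff]
    simp [sub_mul, Finset.sum_sub_distrib, Pi.single_apply, hA, (mem_revoluteAxis α i z).1 hz]

theorem inner_map_sub_map_zero (τ : Space ≃ᵃⁱ[ℝ] Space) (x y : Space) :
    ⟪τ x - τ y, τ 0⟫ = (‖τ x‖ ^ 2 - ‖τ y‖ ^ 2 - ‖x‖ ^ 2 + ‖y‖ ^ 2) / 2 := by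
  have h : ∀ z, ‖τ z - τ 0‖ ^ 2 = ‖z‖ ^ 2 := fun z => by
    rw [map_sub_map, LinearIsometryEquiv.norm_map, sub_zero]
  have h1 := h x
  have h2 := h y
  rw [norm_sub_sq_real] at h1 h2
  rw [inner_sub_left]
  linarith

/-- A transversal, with direction `n`, meets the axes in points `x i`. The images of the segments
`[x (i - 1), x i]` form a closed polygon, since consecutive ones have the common
point `α (i - 1) (x (i - 1)) = α i (x (i - 1))`. Its sides `w i` along the homologous directions yield
the relation which the solution planes require. -/
theorem IsTransversal.exists_relation {α : Fin 4 → Space ≃ᵃⁱ[ℝ] Space}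
    {l : AffineSubspace ℝ Space} (hl : IsTransversal α l) {n : Space} (hn : n ∈ l.direction)
    (hn0 : n ≠ 0) :
    ∃ (x : Fin 4 → Space) (w : Fin 4 → ℝ), (∀ i, x i ∈ l) ∧ (∀ i, x i ∈ revoluteAxis α i) ∧
      (∀ i, w i • n = x i - x (i + 3)) ∧ ∑ i, w i = 0 ∧
      ∑ i, w i • (α i).linearIsometryEquiv n = 0 ∧
      ∑ i, w i * ⟪(α i).linearIsometryEquiv n, α i 0⟫ = 0 := by
  choose x hxl hxr using hl.2
  have hw : ∀ i, ∃ w : ℝ, w • n = x i - x (i + 3) := by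
    intro i
    rw [← Submodule.mem_span_singleton, ← hl.1.direction_eq_span hn hn0]
    exact AffineSubspace.vsub_mem_direction (hxl i) (hxl (i + 3))
  choose w hw using hw
  have hside : ∀ i, w i • (α i).linearIsometryEquiv n = α i (x i) - α i (x (i + 3)) := by
    intro i
    rw [← map_smul, hw, map_sub_map]
  have h0 := (mem_revoluteAxis α 0 _).1 (hxr 0)
  have h1 := (mem_revoluteAxis α 1 _).1 (hxr 1)
  have h2 := (mem_revoluteAxis α 2 _).1 (hxr 2)
  have h3 := (mem_revoluteAxis α 3 _).1 (hxr 3)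
  simp only [Fin.reduceAdd] at h0 h1 h2 h3
  refine ⟨x, w, hxl, hxr, hw, ?_, ?_, ?_⟩
  · refine (smul_eq_zero.1 (?_ : (∑ i, w i) • n = 0)).resolve_right hn0
    rw [Finset.sum_smul]
    simp only [hw, Fin.sum_univ_four, Fin.reduceAdd, zero_add]
    abel
  · simp only [hside, Fin.sum_univ_four, Fin.reduceAdd, zero_add, h0, h1, h2, h3]
    abel
  · simp only [← real_inner_smul_left, hside, inner_map_sub_map_zero]
    simp only [Fin.sum_univ_four, Fin.reduceAdd, zero_add, h0, h1, h2, h3]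
    ring

theorem mem_conePlanes_of_transversal {α : Fin 4 → Space ≃ᵃⁱ[ℝ] Space}
    (hpoint : ¬ ∃ x : Space, ∀ i, x ∈ revoluteAxis α i)
    {l : AffineSubspace ℝ Space} (hl : IsTransversal α l)
    (htrans : ¬ HomologousParallelToPlane α l) {e : OrientedPlane}
    (he : e ∈ orthogonalPencil l) : e ∈ conePlanes α := by
  rw [mem_orthogonalPencil] at he
  obtain ⟨x, w, -, hxr, hw, hw1, hwn, hwo⟩ := hl.exists_relation he e.normal_ne_zero
  refine mem_conePlanes_of_relation
    (fun h => htrans (homologousParallelToPlane_of_inner_eq_zero hl.1 he e.normal_ne_zero h))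
    ?_ hw1 hwn hwo
  rintro rfl
  have hstep : ∀ i, x i = x (i + 1) := fun i => by
    have h := hw (i + 1)
    rw [Pi.zero_apply, zero_smul, eq_comm, sub_eq_zero, add_assoc,
      show (1 + 3 : Fin 4) = 0 from rfl, add_zero] at h
    exact h.symm
  exact hpoint ⟨x 0, fun i => eq_apply_zero_of_step hstep i ▸ hxr i⟩

/-! ### Disjointness of the pencils -/

/-- Two parallel axes make at most two of the homologous directions distinct. -/
theorem not_parallel_axes {α : Fin 4 → Space ≃ᵃⁱ[ℝ] Space} (hα : IsRotationQuadrangle α)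
    (haxis : ∀ i, ¬ HomologousParallelToPlane α (revoluteAxis α i)) {i j : Fin 4} (hij : i ≠ j)
    {n : Space} (hn0 : n ≠ 0) (hi : n ∈ (revoluteAxis α i).direction)
    (hj : n ∈ (revoluteAxis α j).direction) : False := by
  obtain ⟨z, hz⟩ := (hα.isLine_revoluteAxis i).1
  obtain ⟨z', hz'⟩ := (hα.isLine_revoluteAxis j).1
  have hi' := (mem_direction_revoluteAxis hz _).1 hi
  have hj' := (mem_direction_revoluteAxis hz' _).1 hj
  have hab : ∀ f : Fin 4 → Space, f i = f (i + 1) → f j = f (j + 1) →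
      ∃ a b, ∀ k, f k = a ∨ f k = b := by
    intro f h1 h2
    have h : ∃ a b : Fin 4, ∀ k, k = a ∨ k = b ∨ (k = i ∧ (i + 1 = a ∨ i + 1 = b)) ∨
        (k = j ∧ (j + 1 = a ∨ j + 1 = b)) ∨ (k = i ∧ i + 1 = j ∧ (j + 1 = a ∨ j + 1 = b)) ∨
        (k = j ∧ j + 1 = i ∧ (i + 1 = a ∨ i + 1 = b)) := by
      clear h1 h2 hi hj hi' hj' hz hz'
      revert i j
      decide
    obtain ⟨a, b, h⟩ := h
    refine ⟨f a, f b, fun k => ?_⟩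
    have := h k
    grind
  obtain ⟨a, b, hab⟩ := hab (fun k => (α k).linearIsometryEquiv n) hi' hj'
  obtain ⟨m, hm0, hma, hmb⟩ := exists_ne_zero_inner_eq_zero a b
  refine haxis i (homologousParallelToPlane_of_inner_eq_zero (hα.isLine_revoluteAxis i) hi hn0
    ⟨m, hm0, fun k => ?_⟩)
  rcases hab k with h | h
  · exact (congrArg _ h).trans hma
  · exact (congrArg _ h).trans hmb

/-- If a transversal were parallel to an axis `r_{i,i+1}`, the relation between the homologous
directions would force it to meet the other three axes in one point. As the transversal
coincides with `r_{i,i+1}`, all four axes would be concurrent. -/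
theorem not_parallel_axis_transversal {α : Fin 4 → Space ≃ᵃⁱ[ℝ] Space}
    (hpoint : ¬ ∃ x : Space, ∀ i, x ∈ revoluteAxis α i)
    {l : AffineSubspace ℝ Space} (hl : IsTransversal α l)
    (htrans : ¬ HomologousParallelToPlane α l) (i : Fin 4)
    {n : Space} (hn0 : n ≠ 0) (hi : n ∈ (revoluteAxis α i).direction)
    (hn : n ∈ l.direction) : False := by
  obtain ⟨x, w, hxl, hxr, hw, -, hwn, -⟩ := hl.exists_relation hn hn0
  have hA := (mem_direction_revoluteAxis (hxr i) _).1 hi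
  have hspan : ∀ m : Space, m ≠ 0 → ∃ k, ⟪m, (α k).linearIsometryEquiv n⟫ ≠ 0 := by
    intro m hm0
    by_contra! h
    exact htrans (homologousParallelToPlane_of_inner_eq_zero hl.1 hn hn0 ⟨m, hm0, h⟩)
  -- the directions `i`, `j`, `k` are independent; the `i`-th and the `(i + 1)`-st coincide
  have hzero : ∀ j k : Fin 4, (∀ t, t = i ∨ t = i + 1 ∨ t = j ∨ t = k) → k ≠ j → k ≠ i →
      k ≠ i + 1 → w k = 0 := by
    intro j k hall hkj hki hki'
    obtain ⟨m, hm0, hm1, hm2⟩ := exists_ne_zero_inner_eq_zero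
      ((α i).linearIsometryEquiv n) ((α j).linearIsometryEquiv n)
    have hother : ∀ t, t ≠ k → ⟪m, (α t).linearIsometryEquiv n⟫ = 0 := by
      intro t ht
      rcases hall t with rfl | rfl | rfl | rfl
      · exact hm1
      · rw [← hA]; exact hm1
      · exact hm2
      · exact absurd rfl ht
    have hk : ⟪m, (α k).linearIsometryEquiv n⟫ ≠ 0 := by
      obtain ⟨t, ht⟩ := hspan m hm0
      by_cases h : t = k
      · rwa [← h]
      · exact absurd (hother t h) ht
    have hsum := congrArg (fun y => ⟪m, y⟫) hwn
    simp only [inner_sum, inner_smul_right, inner_zero_right] at hsum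
    rw [Finset.sum_eq_single k (fun t _ ht => by rw [hother t ht, mul_zero]) (by simp)] at hsum
    exact (mul_eq_zero.1 hsum).resolve_right hk
  have hall : ∀ i t : Fin 4, t = i ∨ t = i + 1 ∨ t = i + 2 ∨ t = i + 3 := by decide
  have hne : ∀ i : Fin 4, i + 2 ≠ i ∧ i + 2 ≠ i + 1 ∧ i + 3 ≠ i ∧ i + 3 ≠ i + 1 ∧
      i + 2 ≠ i + 3 := by decide
  obtain ⟨hne1, hne2, hne3, hne4, hne5⟩ := hne i
  have hw2 : w (i + 2) = 0 := hzero (i + 3) (i + 2)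
    (fun t => by rw [or_comm (a := t = i + 3)]; exact hall i t) hne5 hne1 hne2
  have hw3 : w (i + 3) = 0 := hzero (i + 2) (i + 3) (hall i) hne5.symm hne3 hne4
  have h2 := hw (i + 2)
  have h3 := hw (i + 3)
  rw [hw2, zero_smul, eq_comm, sub_eq_zero, add_assoc, show (2 + 3 : Fin 4) = 1 from rfl] at h2
  rw [hw3, zero_smul, eq_comm, sub_eq_zero, add_assoc, show (3 + 3 : Fin 4) = 2 from rfl] at h3
  refine hpoint ⟨x (i + 1), fun k => ?_⟩
  rcases hall i k with rfl | rfl | rfl | rfl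
  · have h1 := AffineSubspace.vsub_mem_direction (hxl (k + 1)) (hxl k)
    rw [hl.1.direction_eq_span hn hn0, Submodule.mem_span_singleton] at h1
    obtain ⟨t, ht⟩ := h1
    rw [← vsub_vadd (x (k + 1)) (x k), ← ht, AffineSubspace.vadd_mem_iff_mem_direction _ (hxr k)]
    exact Submodule.smul_mem _ _ hi
  · exact hxr _
  · rw [← h2]; exact hxr _
  · rw [← h2, ← h3]; exact hxr _

/-- Two parallel transversals have a third one half-way between them. -/
theorem not_parallel_transversals {α : Fin 4 → Space ≃ᵃⁱ[ℝ] Space}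
    {u v : AffineSubspace ℝ Space} (huv : u ≠ v) (h : ∀ l, IsTransversal α l ↔ l = u ∨ l = v)
    {n : Space} (hn0 : n ≠ 0) (hu : n ∈ u.direction) (hv : n ∈ v.direction) : False := by
  have hut := (h u).2 (Or.inl rfl)
  have hvt := (h v).2 (Or.inr rfl)
  have hud := hut.1.direction_eq_span hu hn0
  have hvd := hvt.1.direction_eq_span hv hn0
  choose x hxu hxr using hut.2
  choose y hyv hyr using hvt.2
  set m := AffineSubspace.mk' (midpoint ℝ (x 0) (y 0)) (ℝ ∙ n) with hm
  have hmem : midpoint ℝ (x 0) (y 0) ∈ m := AffineSubspace.self_mem_mk' _ _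
  have hmt : IsTransversal α m := by
    refine ⟨isLine_mk' _ hn0, fun i => ⟨midpoint ℝ (x i) (y i), ?_, ?_⟩⟩
    · rw [hm, AffineSubspace.mem_mk', midpoint_vsub_midpoint, midpoint_eq_smul_add]
      refine Submodule.smul_mem _ _ (Submodule.add_mem _ ?_ ?_)
      · rw [← hud]
        exact AffineSubspace.vsub_mem_direction (hxu i) (hxu 0)
      · rw [← hvd]
        exact AffineSubspace.vsub_mem_direction (hyv i) (hyv 0)
    · exact AffineMap.lineMap_mem _ (hxr i) (hyr i)
  have hmid : ∀ (s : AffineSubspace ℝ Space) (a b : Space), a ∈ s → midpoint ℝ a b ∈ s → b ∈ s := by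
    intro s a b ha hab
    have := AffineMap.lineMap_mem (2 : ℝ) ha hab
    convert this using 1
    rw [AffineMap.lineMap_apply, midpoint_vsub_left, smul_smul]
    simp
  rcases (h m).1 hmt with h1 | h1
  · rw [h1] at hmem
    exact huv (AffineSubspace.ext_of_direction_eq (hud.trans hvd.symm)
      ⟨y 0, hmid u _ _ (hxu 0) hmem, hyv 0⟩)
  · rw [h1, midpoint_comm] at hmem
    exact huv (AffineSubspace.ext_of_direction_eq (hud.trans hvd.symm)
      ⟨x 0, hxu 0, hmid v _ _ (hyv 0) hmem⟩)

theorem IsLine.orthogonalPencil_nonempty {l : AffineSubspace ℝ Space} (hl : IsLine l) :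
    (orthogonalPencil l).Nonempty := by
  obtain ⟨u, hu0, hu⟩ := hl.exists_direction_eq_span
  refine ⟨⟨‖u‖⁻¹ • u, 0, ?_⟩, ?_⟩
  · rw [norm_smul, norm_inv, norm_norm, inv_mul_cancel₀ (norm_ne_zero_iff.2 hu0)]
  · rw [mem_orthogonalPencil, hu]
    exact Submodule.smul_mem _ _ (Submodule.mem_span_singleton_self u)

theorem sixLines_cases (α : Fin 4 → Space ≃ᵃⁱ[ℝ] Space) (u v : AffineSubspace ℝ Space)
    (k : Fin 6) : (∃ i : Fin 4, k = i.castLE (by norm_num) ∧ sixLines α u v k = revoluteAxis α i) ∨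
      (k = 4 ∧ sixLines α u v k = u) ∨ (k = 5 ∧ sixLines α u v k = v) := by
  fin_cases k
  · exact Or.inl ⟨0, rfl, rfl⟩
  · exact Or.inl ⟨1, rfl, rfl⟩
  · exact Or.inl ⟨2, rfl, rfl⟩
  · exact Or.inl ⟨3, rfl, rfl⟩
  · exact Or.inr (Or.inl ⟨rfl, rfl⟩)
  · exact Or.inr (Or.inr ⟨rfl, rfl⟩)

theorem mainTheorem2
    (α : Fin 4 → Space ≃ᵃⁱ[ℝ] Space)
    (hα : IsRotationQuadrangle α)
    -- the axes do not all pass through one point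
    (hpoint : ¬ ∃ x : Space, ∀ i, x ∈ revoluteAxis α i)
    -- the axes are not all parallel to one plane
    (hplane : ¬ ∃ n : Space, n ≠ 0 ∧ ∀ i, ∀ d ∈ (revoluteAxis α i).direction, inner ℝ n d = 0)
    -- neither an axis nor a transversal is one of the spurious directions
    (haxis : ∀ i, ¬ HomologousParallelToPlane α (revoluteAxis α i))
    (htrans : ∀ l, IsTransversal α l → ¬ HomologousParallelToPlane α l) :
    (∀ e : OrientedPlane, e ∈ conePlanes α ↔
      (∃ i, e ∈ orthogonalPencil (revoluteAxis α i)) ∨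
        ∃ l, IsTransversal α l ∧ e ∈ orthogonalPencil l) ∧
    (∀ u v : AffineSubspace ℝ Space, u ≠ v → (∀ l, IsTransversal α l ↔ l = u ∨ l = v) →
      conePlanes α = ⋃ k, orthogonalPencil (sixLines α u v k) ∧
      (∀ j k, j ≠ k →
        Disjoint (orthogonalPencil (sixLines α u v j)) (orthogonalPencil (sixLines α u v k))) ∧
      (Set.range fun k => orthogonalPencil (sixLines α u v k)).ncard = 6) := by
  have hmain : ∀ e : OrientedPlane, e ∈ conePlanes α ↔
      (∃ i, e ∈ orthogonalPencil (revoluteAxis α i)) ∨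
        ∃ l, IsTransversal α l ∧ e ∈ orthogonalPencil l := by
    refine fun e => ⟨exists_orthogonal_of_mem_conePlanes hα hplane, ?_⟩
    rintro (⟨i, he⟩ | ⟨l, hl, he⟩)
    · exact mem_conePlanes_of_axis hα (haxis i) he
    · exact mem_conePlanes_of_transversal hpoint hl (htrans l hl) he
  refine ⟨hmain, fun u v huv h => ?_⟩
  have hut := (h u).2 (Or.inl rfl)
  have hvt := (h v).2 (Or.inr rfl)
  have hdisj : ∀ j k, j ≠ k → Disjoint (orthogonalPencil (sixLines α u v j))
      (orthogonalPencil (sixLines α u v k)) := by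
    intro j k hjk
    rw [Set.disjoint_left]
    intro e hj hk
    rw [mem_orthogonalPencil] at hj hk
    have hn0 := e.normal_ne_zero
    rcases sixLines_cases α u v j with ⟨i, rfl, h1⟩ | ⟨rfl, h1⟩ | ⟨rfl, h1⟩ <;>
    rcases sixLines_cases α u v k with ⟨i', rfl, h2⟩ | ⟨rfl, h2⟩ | ⟨rfl, h2⟩ <;>
    rw [h1] at hj <;> rw [h2] at hk
    · exact not_parallel_axes hα haxis (fun hii => hjk (congrArg _ hii)) hn0 hj hk
    · exact not_parallel_axis_transversal hpoint hut (htrans u hut) i hn0 hj hk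
    · exact not_parallel_axis_transversal hpoint hvt (htrans v hvt) i hn0 hj hk
    · exact not_parallel_axis_transversal hpoint hut (htrans u hut) i' hn0 hk hj
    · exact hjk rfl
    · exact not_parallel_transversals huv h hn0 hj hk
    · exact not_parallel_axis_transversal hpoint hvt (htrans v hvt) i' hn0 hk hj
    · exact not_parallel_transversals huv h hn0 hk hj
    · exact hjk rfl
  have hline : ∀ k, IsLine (sixLines α u v k) := by
    intro k
    rcases sixLines_cases α u v k with ⟨i, -, h1⟩ | ⟨-, h1⟩ | ⟨-, h1⟩ <;> rw [h1]
    · exact hα.isLine_revoluteAxis i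
    · exact hut.1
    · exact hvt.1
  refine ⟨?_, hdisj, ?_⟩
  · ext e
    rw [hmain, Set.mem_iUnion]
    constructor
    · rintro (⟨i, he⟩ | ⟨l, hl, he⟩)
      · refine ⟨i.castLE (by norm_num), ?_⟩
        fin_cases i <;> exact he
      · rcases (h l).1 hl with rfl | rfl
        · exact ⟨4, he⟩
        · exact ⟨5, he⟩
    · rintro ⟨k, he⟩
      rcases sixLines_cases α u v k with ⟨i, -, h1⟩ | ⟨-, h1⟩ | ⟨-, h1⟩ <;> rw [h1] at he
      · exact Or.inl ⟨i, he⟩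
      · exact Or.inr ⟨u, hut, he⟩
      · exact Or.inr ⟨v, hvt, he⟩
  · have hinj : Function.Injective fun k => orthogonalPencil (sixLines α u v k) := by
      intro j k hjk
      by_contra hne
      have hd := hdisj j k hne
      simp only at hjk
      rw [hjk, disjoint_self] at hd
      exact (hline k).orthogonalPencil_nonempty.ne_empty hd
    rw [← Nat.card_coe_set_eq, Nat.card_range_of_injective hinj, Nat.card_eq_fintype_card,
      Fintype.card_fin]
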